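/- **Theorem 1.** Let $N\ge 0$ be an integer and let $p,q,a,b,c\in\mathbb C$ be non-zero. Let $P,Q\in\mathbb C\setminus\{0\}$ satisfy $P^2=(p^2-a^2)(p^2-b^2)$ and $Q^2=(q^2-a^2)(q^2-b^2)$. Let $\mathcal A_+,\mathcal A_-$ be invertible lower triangular Toeplitz $N\times N$ complex matrices, and fix a holomorphic branch of $z\mapsto z^{1/2}$ near $c$. For $n,m,\alpha,\beta\in\mathbb Z$, an integer $l\ge 0$ and $0\le s\le N-1$ put $$\phi^{\pm}_s(\alpha,\beta,l)=\frac1{(2s)!}\,\partial_k^{2s}\Big[(p\pm k)^n(q\pm k)^m(a\pm k)^\alpha(b\pm k)^\beta(c\pm k)^{l+\frac12}\Big]_{k=0},$$ $$\Phi(\alpha,\beta,l)=\mathcal A_+(\phi^+_0,\dots,\phi^+_{N-1})^T+\mathcal A_-(\phi^-_0,\dots,\phi^-_{N-1})^T .$$ Let $C_{\alpha,\beta}(a,b)=\det\big(\Phi(\alpha,\beta,0),\Phi(\alpha,\beta,1),\dots,\Phi(\alpha,\beta,N-1)\big)$. The function $f=C_{0,0}(a,b)$ of $(n,m)$ does not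 depend on $a,b$. Set $$S(a,b)=-\frac{(ab)^N C_{-1,-1}(a,b)-f}{(a+b)\,f}$$ at all points $(n,m)$ where $f\neq0$; for $b=-a$ the singularity of the right-hand side in $b$ is removable, and $S(a,-a)$ denotes its limit as $b\to -a$. The functions $S(\pm a,\pm b)$ are obtained by replacing $a,b$ by $\pm a,\pm b$ throughout, with the same $N,p,q,c,\mathcal A_\pm$. Write $\tilde g(n,m)=g(n+1,m)$ and $\hat g(n,m)=g(n,m+1)$. Then the following hold. 1. For each of the four choices of signs, with $(a_1,b_1)=(\pm a,\pm b)$, the function $S=S(a_1,b_1)$ is a quotient of two polynomials in $(n,m)$ on the set where $f\ne0$, and the denominator has no zero on that set. Moreover, at every $(n,m)\in\mathbb Z^2$ with $f,\tilde f,\hat f,\hat{\tilde f}$ all non-zero, $S$ satisfies the NQC equation $$\big(1+(p-a_1)S-(p+b_1)\tilde S\big)\big(1-(p+a_1)\hat{\tilde S}+(p-b_1)\hat S\big)=\big(1-(q+a_1)\hat{\tilde S}+(q-b_1)\tilde S\big)\big(1+(q-a_1)S-(q+b_1)\hat S\big).$$ 2. Let $A,B,C,D,\delta\in\mathbb C$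 be constants with $$AD(a+b)^2-BC(a-b)^2=-\frac{\delta^2}{16ab},$$ let $$F(a,b)=\Big(\frac{P}{(p-a)(p-b)}\Big)^n\Big(\frac{Q}{(q-a)(q-b)}\Big)^m ,$$ where $F(\pm a,\pm b)$ is obtained by replacing $a,b$ by $\pm a,\pm b$ with the same $P,Q$, and let $$u=AF(a,b)[1-(a+b)S(a,b)]+BF(a,-b)[1-(a-b)S(a,-b)]+CF(-a,b)[1+(a-b)S(-a,b)]+DF(-a,-b)[1+(a+b)S(-a,-b)].$$ At every $(n,m)\in\mathbb Z^2$ with $f,\tilde f,\hat f,\hat{\tilde f}$ all non-zero, $u$ satisfies the re-parameterized $\mathrm{Q3}_\delta$ equation $$P(u\hat u+\tilde u\hat{\tilde u})-Q(u\tilde u+\hat u\hat{\tilde u})=(p^2-q^2)\Big((\tilde u\hat u+u\hat{\tilde u})+\frac{\delta^2}{4PQ}\Big).$$ -/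

import Mathlib

open Filter Topology

noncomputable section

namespace LatticeQ3

/-- `r` is a holomorphic branch of the square root near the point `c`. -/
def IsSqrtBranch (r : ℂ → ℂ) (c : ℂ) : Prop :=
  AnalyticAt ℂ r c ∧ ∀ᶠ z in 𝓝 c, r z ^ 2 = z

/-- Lower triangular Toeplitz matrices. -/
def IsLowerToeplitz {N : ℕ} (M : Matrix (Fin N) (Fin N) ℂ) : Prop :=
  ∃ t : ℕ → ℂ, ∀ i j : Fin N, M i j = if j ≤ i then t ((i : ℕ) - (j : ℕ)) else 0

/-- The entry `φ_s^σ(n, m, α, β, l)`, where `σ = 1` or `σ = -1`: the Taylor coefficient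
`(1/(2s)!) ∂_k^{2s} [(p+σk)^n (q+σk)^m (a+σk)^α (b+σk)^β (c+σk)^{l+1/2}]` at `k = 0`.
The half-integer power `z^{l+1/2}` is `z^l r(z)`, with `r` a branch of the square root near `c`. -/
def phi (p q a b c : ℂ) (r : ℂ → ℂ) (σ : ℂ) (n m α β : ℤ) (l s : ℕ) : ℂ :=
  (1 / ((2 * s).factorial : ℂ)) *
    iteratedDeriv (2 * s) (fun k : ℂ =>
      (p + σ * k) ^ n * (q + σ * k) ^ m * (a + σ * k) ^ α * (b + σ * k) ^ β *
        ((c + σ * k) ^ l * r (c + σ * k))) 0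

/-- The basic column vector `Φ(α, β, l) = 𝒜₊ Φ⁺(α, β, l) + 𝒜₋ Φ⁻(α, β, l)`. -/
def Phi {N : ℕ} (Ap Am : Matrix (Fin N) (Fin N) ℂ) (p q a b c : ℂ) (r : ℂ → ℂ)
    (n m α β : ℤ) (l : ℕ) : Fin N → ℂ :=
  Ap.mulVec (fun s : Fin N => phi p q a b c r 1 n m α β l s) +
    Am.mulVec (fun s : Fin N => phi p q a b c r (-1) n m α β l s)

/-- The Casoratian `|Φ(α, β, 0), Φ(α, β, 1), …, Φ(α, β, N - 1)|`. -/
def casoratian {N : ℕ} (Ap Am : Matrix (Fin N) (Fin N) ℂ) (p q a b c : ℂ) (r : ℂ → ℂ)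
    (n m α β : ℤ) : ℂ :=
  Matrix.det (Matrix.of fun i l : Fin N => Phi Ap Am p q a b c r n m α β l i)

/-- The function `f`, the Casoratian with `α = β = 0`. It does not depend on the parameters
`a`, `b`, which enter `φ` only through the factors `(a ± k)^α (b ± k)^β`; they are set to `1`. -/
def fCas {N : ℕ} (Ap Am : Matrix (Fin N) (Fin N) ℂ) (p q c : ℂ) (r : ℂ → ℂ) (n m : ℤ) : ℂ :=
  casoratian Ap Am p q 1 1 c r n m 0 0

/-- `ϑ(a, b) = (ab)^N |(0, 1, …, N - 1)_{-1,-1}|`. -/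
def vartheta {N : ℕ} (Ap Am : Matrix (Fin N) (Fin N) ℂ) (p q c : ℂ) (r : ℂ → ℂ)
    (a b : ℂ) (n m : ℤ) : ℂ :=
  (a * b) ^ N * casoratian Ap Am p q a b c r n m (-1) (-1)

/-- `S(a, b) = θ / f` with `θ = -(ϑ(a, b) - f) / (a + b)`. As `ϑ(a, -a) = f`, the singularity at
`b = -a` is removable, and there `θ` is given its limit, `-∂_b ϑ(a, b)`. -/
def S {N : ℕ} (Ap Am : Matrix (Fin N) (Fin N) ℂ) (p q c : ℂ) (r : ℂ → ℂ)
    (a b : ℂ) (n m : ℤ) : ℂ :=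
  open Classical in
  (if a + b = 0 then -deriv (fun x : ℂ => vartheta Ap Am p q c r a x n m) b
    else -(1 / (a + b)) * (vartheta Ap Am p q c r a b n m - fCas Ap Am p q c r n m)) /
  fCas Ap Am p q c r n m

/-- `f` vanishes at none of the four vertices of the elementary square based at `(n, m)`. -/
def NonvanishingOnSquare (f : ℤ → ℤ → ℂ) (n m : ℤ) : Prop :=
  f n m ≠ 0 ∧ f (n + 1) m ≠ 0 ∧ f n (m + 1) ≠ 0 ∧ f (n + 1) (m + 1) ≠ 0

/-- On the set where `f ≠ 0`, `T` is a quotient of two polynomials in `(n, m)`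
whose denominator has no zero there. -/
def IsRationalWhere (f T : ℤ → ℤ → ℂ) : Prop :=
  ∃ X Y : MvPolynomial (Fin 2) ℂ, ∀ n m : ℤ, f n m ≠ 0 →
    MvPolynomial.eval ![(n : ℂ), (m : ℂ)] Y ≠ 0 ∧
      T n m = MvPolynomial.eval ![(n : ℂ), (m : ℂ)] X / MvPolynomial.eval ![(n : ℂ), (m : ℂ)] Y

/-- The Nijhoff-Quispel-Capel equation with parameters `a`, `b` on the square based at `(n, m)`,
with the denominators of its two sides cleared. -/
def NQC (p q a b : ℂ) (T : ℤ → ℤ → ℂ) (n m : ℤ) : Prop :=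
  (1 + (p - a) * T n m - (p + b) * T (n + 1) m) *
      (1 - (p + a) * T (n + 1) (m + 1) + (p - b) * T n (m + 1)) =
    (1 - (q + a) * T (n + 1) (m + 1) + (q - b) * T (n + 1) m) *
      (1 + (q - a) * T n m - (q + b) * T n (m + 1))

/-- The re-parameterized equation `Q3_δ` on the square based at `(n, m)`. -/
def Q3 (p P q Q δ : ℂ) (u : ℤ → ℤ → ℂ) (n m : ℤ) : Prop :=
  P * (u n m * u n (m + 1) + u (n + 1) m * u (n + 1) (m + 1)) -
      Q * (u n m * u (n + 1) m + u n (m + 1) * u (n + 1) (m + 1)) =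
    (p ^ 2 - q ^ 2) *
      ((u (n + 1) m * u n (m + 1) + u n m * u (n + 1) (m + 1)) + δ ^ 2 / (4 * P * Q))

/-- `F(a, b) = (P / ((p - a)(p - b)))^n (Q / ((q - a)(q - b)))^m`. -/
def F (p P q Q a b : ℂ) (n m : ℤ) : ℂ :=
  (P / ((p - a) * (p - b))) ^ n * (Q / ((q - a) * (q - b))) ^ m

/-- The function `u`, in terms of a family `T(a, b)` of lattice functions. -/
def uSol (p P q Q a b A B C D : ℂ) (T : ℂ → ℂ → ℤ → ℤ → ℂ) (n m : ℤ) : ℂ :=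
  A * F p P q Q a b n m * (1 - (a + b) * T a b n m) +
    B * F p P q Q a (-b) n m * (1 - (a - b) * T a (-b) n m) +
    C * F p P q Q (-a) b n m * (1 + (a - b) * T (-a) b n m) +
    D * F p P q Q (-a) (-b) n m * (1 + (a + b) * T (-a) (-b) n m)

end LatticeQ3

end

/-! Even-order Taylor coefficients at 0 do not see `k ↦ -k`, so `φ⁺ = φ⁻`, and every Casoratian is
`det (Ap + Am)` times a determinant `evenDet` of even coefficients of one power series `W`. Three
operations on `W` carry the structure. A lattice shift appends a linear factor `p + k` or `q + k`.
Bordering by a row of powers of `x` appends `k - x`. An even factor `x² - k²` only rescales the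
determinant, so `(a + k)⁻¹` may be traded for `a - k`. A three-term Plücker relation for bordered
determinants (`evenDet_three_term`, `evenDet_bilinear`) then gives, after division by `f f̃`, the
relation `1 - (t + b) S̃(a, b) + (t - a) S(a, b) = Ṽ(a) V(b)` on each lattice edge
(`edgeRelation_sval`); the case `b = -a` comes from differentiation.

The rest is algebra from this relation and the symmetry of `S`. In NQC each factor is a product of
two values of `V`, and both sides multiply the same four. For Q3, `P` and `Q` are split into square
roots and `F` into phases, which makes `u` a bilinear expression on edges: combinations of
neighbouring values of `u` equal a fixed 2×2 form applied to vectors `x` (from `±a`) and `y` (from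
`±b`). Brackets of neighbouring vectors are constant, and the form has determinant `δ²/(16ab)`;
planar Plücker relations eliminate the vectors (`q3_of_coupling`).

Rationality holds because `W` is `p^n q^m` times a series with coefficients polynomial in `(n, m)`,
and the scalar cancels in `S`. -/

open Filter Topology

noncomputable section

namespace LatticeQ3

/-! ### Plücker relations for bordered determinants of even coefficients. -/

section Determinants

open Matrix

variable {R : Type*} [CommRing R]

/-- Three-term Plücker relation: `v ↦ det (v, M)` restricted to the first `n + 1` coordinates is a
linear form killing the rows of `M`. -/
theorem plucker_three_term {n : ℕ} (M : Fin n → Fin (n + 2) → R) (x b y : Fin (n + 2) → R)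
    (ℓ : (Fin (n + 2) → R) → R)
    (hℓ : ∀ v, ℓ v = det (of (vecCons (fun j : Fin (n + 1) => v j.castSucc)
      fun i j => M i j.castSucc))) :
    det (of (vecCons y (vecCons b M))) * ℓ x + det (of (vecCons x (vecCons y M))) * ℓ b =
      det (of (vecCons x (vecCons b M))) * ℓ y := by
  obtain ⟨w, hw⟩ : ∃ w : Fin (n + 2) → R, ∀ v, ℓ v = ∑ j, v j * w j := by
    refine ⟨Fin.lastCases (motive := fun _ => R) 0 fun j : Fin (n + 1) => (-1) ^ (j : ℕ) *
      det (of fun (i k : Fin n) => M i (Fin.castSucc (j.succAbove k))), fun v => ?_⟩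
    rw [hℓ, det_succ_row_zero]
    symm
    rw [Fin.sum_univ_castSucc, Fin.lastCases_last, mul_zero, add_zero]
    refine Finset.sum_congr rfl fun j _ => ?_
    rw [Fin.lastCases_castSucc]
    change _ = (-1) ^ (j : ℕ) * v j.castSucc * _
    rw [mul_comm ((-1) ^ (j : ℕ)) (v _), mul_assoc]
    rfl
  have hM : ∀ i, ℓ (M i) = 0 := fun i => by
    rw [hℓ]
    exact det_zero_of_row_eq (i := 0) (j := i.succ) (Fin.succ_ne_zero i).symm (by ext j; simp)
  -- Cramer's rule expands `det (x, b, M) • y` in the rows `x, b, M` over any commutative ring.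
  -- Applying `ℓ` kills the rows of `M` and leaves the terms of `x` and `b`.
  have key := mulVec_cramer (of (vecCons x (vecCons b M)))ᵀ y
  have h := congrArg (fun v => ∑ j, v j * w j) key
  simp only [mulVec, dotProduct, Pi.smul_apply, smul_eq_mul, det_transpose, transpose_apply] at h
  simp only [Finset.sum_mul, mul_assoc] at h
  rw [Finset.sum_comm, ← Finset.mul_sum, ← hw] at h
  have e : ∀ (v : Fin (n + 2) → R) (t : R), ∑ j, v j * (t * w j) = t * ℓ v := fun v t => by
    rw [hw, Finset.mul_sum]
    exact Finset.sum_congr rfl fun j _ => by ring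
  simp only [e] at h
  rw [← h]
  simp only [Fin.sum_univ_succ (n := n + 1), Fin.sum_univ_succ (n := n), cramer_transpose_apply]
  rw [show of (vecCons x (vecCons b M)) 0 = x from rfl,
    show of (vecCons x (vecCons b M)) (Fin.succ 0) = b from rfl,
    Finset.sum_eq_zero, add_zero]
  rotate_left
  · exact fun i _ => mul_eq_zero_of_right _ (hM i)
  congr 3
  · ext i j
    refine Fin.cases ?_ (fun i => ?_) i <;> simp [updateRow_apply]
  · ext i j
    refine Fin.cases ?_ (fun i => Fin.cases ?_ (fun i => ?_) i) i <;>
      simp [updateRow_apply, Fin.ext_iff]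

/-- Column reduction of a matrix whose first row consists of the powers of `x`. -/
theorem det_vecCons_pow {n : ℕ} (x : R) (M : Fin n → ℕ → R) :
    det (of (vecCons (fun j : Fin (n + 1) => x ^ (j : ℕ)) fun i j => M i j)) =
      det (of fun i j : Fin n => M i (j + 1) - x * M i j) := by
  set A : Matrix (Fin (n + 1)) (Fin (n + 1)) R :=
    of (vecCons (fun j : Fin (n + 1) => x ^ (j : ℕ)) fun i j => M i j) with hA
  have h := det_eq_of_forall_col_eq_smul_add_pred (A := A)
    (B := of fun i => Fin.cases (A i 0) fun j => A i j.succ - x * A i j.castSucc)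
    (fun _ => x) (fun i => by simp) (fun i j => by simp)
  rw [h, det_succ_row_zero, Fin.sum_univ_succ, Finset.sum_eq_zero]
  · simp only [Fin.val_zero, pow_zero, one_mul, add_zero, of_apply, Fin.cases_zero]
    rw [show A 0 0 = 1 by simp [hA], one_mul]
    congr 1
  · intro j _
    simp [hA, pow_succ']

/-- The determinant of the even coefficients of `W X ^ l`, `l < N`. -/
def evenDet (N : ℕ) (W : PowerSeries R) : R :=
  det (of fun i l : Fin N => PowerSeries.coeff (2 * (i : ℕ)) (W * PowerSeries.X ^ (l : ℕ)))

theorem map_evenDet {T : Type*} [CommRing T] (g : R →+* T) (N : ℕ) (W : PowerSeries R) :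
    g (evenDet N W) = evenDet N (PowerSeries.map g W) := by
  rw [evenDet, RingHom.map_det, evenDet]
  congr 1
  ext i l
  simp [← PowerSeries.coeff_map]

theorem evenDet_C_mul (N : ℕ) (t : R) (W : PowerSeries R) :
    evenDet N (PowerSeries.C t * W) = t ^ N * evenDet N W := by
  have := det_smul (of fun i l : Fin N =>
    PowerSeries.coeff (2 * (i : ℕ)) (W * PowerSeries.X ^ (l : ℕ))) t
  rw [Fintype.card_fin] at this
  rw [evenDet, evenDet, ← this]
  congr 1
  ext i l
  simp [mul_assoc]

/-- `evenDet` may be computed in the basis `(c + X) ^ l`. -/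
theorem det_coeff_shift (N : ℕ) (c : R) (W : PowerSeries R) :
    det (of fun i l : Fin N => PowerSeries.coeff (2 * (i : ℕ))
      (W * (PowerSeries.C c + PowerSeries.X) ^ (l : ℕ))) = evenDet N W := by
  nontriviality R
  let P : Fin N → Polynomial R := fun l => (Polynomial.X + Polynomial.C c) ^ (l : ℕ)
  have hd : ∀ i, (P i).natDegree = i := fun i => Polynomial.natDegree_pow_X_add_C _ _
  -- The change of basis from `X ^ l` to the monic `(X + c) ^ l` is unitriangular.
  have h1 := det_matrixOfPolynomials P hd fun i => Polynomial.monic_X_add_C c |>.pow _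
  rw [← mul_one (evenDet N W), ← h1, evenDet, ← det_mul]
  congr 1
  ext i l
  have h2 : (PowerSeries.C c + PowerSeries.X) ^ (l : ℕ) =
      ∑ j : Fin N, PowerSeries.C ((P l).coeff j) * PowerSeries.X ^ (j : ℕ) := by
    have h3 := congrArg (Polynomial.coeToPowerSeries.ringHom (R := R))
      ((P l).as_sum_range_C_mul_X_pow' (n := N) (by rw [hd]; exact l.2))
    rw [Finset.sum_range] at h3
    simpa [P, add_comm] using h3
  rw [mul_apply, of_apply, h2, Finset.mul_sum, map_sum]
  refine Finset.sum_congr rfl fun j _ => ?_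
  rw [of_apply, of_apply, mul_left_comm, PowerSeries.coeff_C_mul, mul_comm]

/-- The linear factor `X - x`. -/
def lin (x : R) : PowerSeries R := PowerSeries.X - PowerSeries.C x

theorem coeff_mul_lin (k : ℕ) (W : PowerSeries R) (x : R) (j : ℕ) :
    PowerSeries.coeff k (W * PowerSeries.X ^ (j + 1)) -
      x * PowerSeries.coeff k (W * PowerSeries.X ^ j) =
      PowerSeries.coeff k (W * lin x * PowerSeries.X ^ j) := by
  rw [← PowerSeries.coeff_C_mul, ← map_sub]
  congr 1
  rw [lin]
  ring

theorem det_vecCons_pow_evenDet (N : ℕ) (W : PowerSeries R) (x : R) :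
    det (of (vecCons (fun j : Fin (N + 1) => x ^ (j : ℕ)) fun (i : Fin N) j =>
      PowerSeries.coeff (2 * (i : ℕ)) (W * PowerSeries.X ^ (j : ℕ)))) = evenDet N (W * lin x) := by
  rw [det_vecCons_pow x fun (i : Fin N) j =>
    PowerSeries.coeff (2 * (i : ℕ)) (W * PowerSeries.X ^ (j : ℕ))]
  simp only [coeff_mul_lin]
  rfl

/-- Reducing columns by the `x`-row turns the `y`-row into `(y - x) y ^ j` and `W` into `W * lin x`;
a single border by `y` remains. -/
theorem det_vecCons_pow_pow_evenDet (N : ℕ) (W : PowerSeries R) (x y : R) :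
    det (of (vecCons (fun j : Fin (N + 2) => x ^ (j : ℕ))
      (vecCons (fun j : Fin (N + 2) => y ^ (j : ℕ)) fun (i : Fin N) j =>
        PowerSeries.coeff (2 * (i : ℕ)) (W * PowerSeries.X ^ (j : ℕ))))) =
      (y - x) * evenDet N (W * lin x * lin y) := by
  have h := det_vecCons_pow x (vecCons (fun j : ℕ => y ^ j) fun (i : Fin N) j =>
    PowerSeries.coeff (2 * (i : ℕ)) (W * PowerSeries.X ^ j))
  have e : (of (vecCons (fun j : Fin (N + 2) => x ^ (j : ℕ))
      (vecCons (fun j : Fin (N + 2) => y ^ (j : ℕ)) fun (i : Fin N) j =>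
        PowerSeries.coeff (2 * (i : ℕ)) (W * PowerSeries.X ^ (j : ℕ))))) =
      of (vecCons (fun j : Fin (N + 2) => x ^ (j : ℕ)) fun i j =>
        (vecCons (fun j : ℕ => y ^ j) fun (i : Fin N) j =>
          PowerSeries.coeff (2 * (i : ℕ)) (W * PowerSeries.X ^ j)) i j) := by
    ext i j
    refine Fin.cases ?_ (fun i => Fin.cases ?_ (fun i => ?_) i) i <;> simp
  rw [e, h, ← det_vecCons_pow_evenDet, det_succ_row_zero, det_succ_row_zero, Finset.mul_sum]
  refine Finset.sum_congr rfl fun j _ => ?_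
  simp only [of_apply, cons_val_zero, submatrix, cons_val_succ, coeff_mul_lin]
  ring

theorem evenDet_three_term (N : ℕ) (W : PowerSeries R) (x b y : R) :
    (b - y) * evenDet N (W * lin y * lin b) * evenDet N (W * lin x) +
      (y - x) * evenDet N (W * lin x * lin y) * evenDet N (W * lin b) =
      (b - x) * evenDet N (W * lin x * lin b) * evenDet N (W * lin y) := by
  have h := plucker_three_term
    (fun (i : Fin N) (j : Fin (N + 2)) =>
      PowerSeries.coeff (2 * (i : ℕ)) (W * PowerSeries.X ^ (j : ℕ)))
    (fun j => x ^ (j : ℕ)) (fun j => b ^ (j : ℕ)) (fun j => y ^ (j : ℕ)) _ fun _ => rfl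
  simp only [det_vecCons_pow_pow_evenDet, Fin.val_castSucc, det_vecCons_pow_evenDet] at h
  exact h

end Determinants

/-! ### Even factors and the bilinear relation. -/

section EvenFactor

open Matrix

variable {K : Type*} [Field K]

/-- Multiplication by `x² - X²` replaces row `i` by `x²` times itself minus row `i - 1`, a
triangular row operation with `x²` on the diagonal. -/
theorem evenDet_mul_sq_sub (N : ℕ) (W : PowerSeries K) {x : K} (hx : x ≠ 0) :
    evenDet N (W * (PowerSeries.C (x ^ 2) - PowerSeries.X ^ 2)) = x ^ (2 * N) * evenDet N W := by
  rw [pow_mul, ← evenDet_C_mul]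
  cases N with
  | zero => simp [evenDet]
  | succ n =>
    symm
    refine det_eq_of_forall_row_eq_smul_add_pred (fun _ => (x ^ 2)⁻¹) (fun j => ?_) fun i j => ?_
    · have : PowerSeries.coeff 0 (W * (PowerSeries.C (x ^ 2) - PowerSeries.X ^ 2) *
          PowerSeries.X ^ (j : ℕ)) = PowerSeries.coeff 0 (PowerSeries.C (x ^ 2) * W *
          PowerSeries.X ^ (j : ℕ)) := by
        simp [mul_comm]
      simpa using this.symm
    · have e : W * (PowerSeries.C (x ^ 2) - PowerSeries.X ^ 2) * PowerSeries.X ^ (j : ℕ) =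
          PowerSeries.C (x ^ 2) * W * PowerSeries.X ^ (j : ℕ) -
            W * PowerSeries.X ^ (j : ℕ) * PowerSeries.X ^ 2 := by ring
      simp only [of_apply, Fin.val_succ, Fin.val_castSucc, e, map_sub]
      rw [show 2 * ((i : ℕ) + 1) = 2 * (i : ℕ) + 2 by ring, PowerSeries.coeff_mul_X_pow,
        mul_assoc (PowerSeries.C (x ^ 2)),
        PowerSeries.coeff_C_mul, PowerSeries.coeff_C_mul]
      field_simp
      ring

theorem evenDet_lin_lin_neg (N : ℕ) (W : PowerSeries K) {a : K} (ha : a ≠ 0) :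
    evenDet N (W * lin a * lin (-a)) = (-1) ^ N * a ^ (2 * N) * evenDet N W := by
  rw [mul_assoc W, mul_assoc (_ ^ N), ← evenDet_mul_sq_sub N W ha, ← evenDet_C_mul]
  congr 1
  simp only [lin, map_neg, map_one, map_pow]
  ring

/-- The bilinear relation behind the discrete evolution of `ϑ(a, b)`. -/
theorem evenDet_bilinear (N : ℕ) (W : PowerSeries K) {a : K} (ha : a ≠ 0) (b x : K) :
    (b - x) * evenDet N (W * lin x * lin a * lin b) * evenDet N W +
      (x + a) * evenDet N (W * lin a * lin b) * evenDet N (W * lin x) =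
      (a + b) * evenDet N (W * lin x * lin a) * evenDet N (W * lin b) := by
  -- The third point is `-a` because `lin a * lin (-a)` is even and leaves each determinant as a
  -- scalar.
  have h := evenDet_three_term N (W * lin a) x b (-a)
  have e : ∀ V : PowerSeries K, ∀ z, evenDet N (V * lin a * z * lin (-a)) =
      (-1) ^ N * a ^ (2 * N) * evenDet N (V * z) := fun V z => by
    rw [← evenDet_lin_lin_neg N (V * z) ha]
    congr 1
    ring
  rw [show W * lin a * lin (-a) * lin b = W * lin a * lin b * lin (-a) by ring, e, e,
    evenDet_lin_lin_neg N W ha, show W * lin a * lin x = W * lin x * lin a by ring] at h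
  have hne : (-1 : K) ^ N * a ^ (2 * N) ≠ 0 :=
    mul_ne_zero (pow_ne_zero _ (by simp)) (pow_ne_zero _ ha)
  apply mul_left_cancel₀ hne
  linear_combination -h

end EvenFactor

/-! ### Taylor series of powers of linear factors. -/

section Taylor

/-- The Taylor series at `0`. -/
def taylor (h : ℂ → ℂ) : PowerSeries ℂ :=
  PowerSeries.mk fun n => iteratedDeriv n h 0 / (n.factorial : ℂ)

theorem taylor_mul {g h : ℂ → ℂ} (hg : AnalyticAt ℂ g 0) (hh : AnalyticAt ℂ h 0) :
    taylor (fun k => g k * h k) = taylor g * taylor h := by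
  ext n
  rw [PowerSeries.coeff_mul, Finset.Nat.sum_antidiagonal_eq_sum_range_succ_mk]
  simp only [taylor, PowerSeries.coeff_mk]
  rw [iteratedDeriv_fun_mul hg.contDiffAt hh.contDiffAt, Finset.sum_div]
  refine Finset.sum_congr rfl fun i hi => ?_
  have hi' : i ≤ n := Nat.lt_succ_iff.mp (Finset.mem_range.mp hi)
  rw [Nat.cast_choose ℂ hi']
  have h0 : ∀ j : ℕ, (j.factorial : ℂ) ≠ 0 := fun j => by exact_mod_cast j.factorial_ne_zero
  field_simp [h0]

theorem coeff_taylor_zpow {p : ℂ} (hp : p ≠ 0) (n : ℤ) (j : ℕ) :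
    PowerSeries.coeff j (taylor fun k => (p + k) ^ n) =
      p ^ n * (p⁻¹ ^ j / (j.factorial : ℂ) * ∏ i ∈ Finset.range j, ((n : ℂ) - i)) := by
  rw [taylor, PowerSeries.coeff_mk,
    iteratedDeriv_comp_const_add j (fun k : ℂ => k ^ n) p, iteratedDeriv_eq_iterate]
  simp only [add_zero, iter_deriv_zpow]
  rw [zpow_sub₀ hp, zpow_natCast, inv_pow]
  ring

theorem analyticAt_const_add_zpow {p : ℂ} (hp : p ≠ 0) (n : ℤ) :
    AnalyticAt ℂ (fun k : ℂ => (p + k) ^ n) 0 :=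
  AnalyticAt.fun_zpow (by fun_prop) (by simpa using hp)

theorem taylor_zpow_zero (p : ℂ) : taylor (fun k : ℂ => (p + k) ^ (0 : ℤ)) = 1 := by
  ext j
  rw [taylor, PowerSeries.coeff_mk, PowerSeries.coeff_one]
  cases j <;> simp [iteratedDeriv_const]

theorem taylor_zpow_one {p : ℂ} (hp : p ≠ 0) :
    taylor (fun k : ℂ => (p + k) ^ (1 : ℤ)) = PowerSeries.C p + PowerSeries.X := by
  ext j
  rw [coeff_taylor_zpow hp, map_add, PowerSeries.coeff_C, PowerSeries.coeff_X]
  rcases j with _ | _ | j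
  · simp
  · simp [hp]
  · rw [Finset.prod_eq_zero (i := 1) (by simp) (by simp)]
    simp

theorem taylor_zpow_add {p : ℂ} (hp : p ≠ 0) (n n' : ℤ) :
    taylor (fun k : ℂ => (p + k) ^ (n + n')) =
      taylor (fun k => (p + k) ^ n) * taylor (fun k => (p + k) ^ n') := by
  rw [← taylor_mul (analyticAt_const_add_zpow hp n) (analyticAt_const_add_zpow hp n')]
  ext j
  simp only [taylor, PowerSeries.coeff_mk]
  congr 1
  refine Filter.EventuallyEq.iteratedDeriv_eq j ?_
  have : ∀ᶠ k : ℂ in 𝓝 0, p + k ≠ 0 :=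
    ContinuousAt.eventually_ne (by fun_prop) (by simpa using hp)
  filter_upwards [this] with k hk using zpow_add₀ hk n n'

theorem taylor_zpow_succ {p : ℂ} (hp : p ≠ 0) (n : ℤ) :
    taylor (fun k : ℂ => (p + k) ^ (n + 1)) = taylor (fun k => (p + k) ^ n) * lin (-p) := by
  rw [taylor_zpow_add hp, taylor_zpow_one hp, lin, map_neg]
  ring

theorem taylor_zpow_natCast {p : ℂ} (hp : p ≠ 0) (l : ℕ) :
    taylor (fun k : ℂ => (p + k) ^ (l : ℤ)) = (PowerSeries.C p + PowerSeries.X) ^ l := by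
  induction l with
  | zero => simpa using taylor_zpow_zero p
  | succ l ih =>
    rw [Nat.cast_succ, taylor_zpow_add hp, taylor_zpow_one hp, ih, pow_succ]

/-- This is `(a + k)⁻¹ (a² - k²) = a - k`, which trades an inverse factor for a linear one at the
cost of an even factor. -/
theorem lin_mul_taylor_zpow_neg_one {a : ℂ} (ha : a ≠ 0) :
    taylor (fun k : ℂ => (a + k) ^ (-1 : ℤ)) * (PowerSeries.C (a ^ 2) - PowerSeries.X ^ 2) =
      PowerSeries.C (-1) * lin a := by
  have h := taylor_zpow_succ ha (-1)
  rw [show (-1 : ℤ) + 1 = 0 by norm_num, taylor_zpow_zero] at h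
  calc _ = taylor (fun k : ℂ => (a + k) ^ (-1 : ℤ)) * lin (-a) * (PowerSeries.C (-1) * lin a) := by
        simp only [lin, map_neg, map_one, map_pow]
        ring
    _ = _ := by rw [← h, one_mul]

/-- `(1 + k / p) ^ n` as a power series in `k` whose coefficients are polynomials in `n`, the
variable with index `v`. -/
def binomSeries (p : ℂ) (v : Fin 2) : PowerSeries (MvPolynomial (Fin 2) ℂ) :=
  PowerSeries.mk fun j => MvPolynomial.C (p⁻¹ ^ j / (j.factorial : ℂ)) *
    ∏ i ∈ Finset.range j, (MvPolynomial.X v - MvPolynomial.C (i : ℂ))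

theorem taylor_zpow_eq_map {p : ℂ} (hp : p ≠ 0) (n : ℤ) (v : Fin 2) (x : Fin 2 → ℂ)
    (hx : x v = n) : taylor (fun k : ℂ => (p + k) ^ n) =
      PowerSeries.C (p ^ n) * PowerSeries.map (MvPolynomial.eval x) (binomSeries p v) := by
  ext j
  rw [coeff_taylor_zpow hp, PowerSeries.coeff_C_mul, PowerSeries.coeff_map, binomSeries,
    PowerSeries.coeff_mk]
  simp only [map_mul, map_prod, map_sub, MvPolynomial.eval_C, MvPolynomial.eval_X, hx]

end Taylor

/-! ### Casoratians as even-coefficient determinants of the plane wave. -/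

section PlaneWave

variable {p q c : ℂ} {r : ℂ → ℂ}

/-- The Taylor series of the plane wave `(p + k)^n (q + k)^m (c + k)^{1/2}`. -/
def wave (p q c : ℂ) (r : ℂ → ℂ) (n m : ℤ) : PowerSeries ℂ :=
  taylor (fun k => (p + k) ^ n) * taylor (fun k => (q + k) ^ m) * taylor fun k => r (c + k)

theorem wave_succ_left (hp : p ≠ 0) (n m : ℤ) :
    wave p q c r (n + 1) m = wave p q c r n m * lin (-p) := by
  rw [wave, wave, taylor_zpow_succ hp]
  ring

theorem wave_succ_right (hq : q ≠ 0) (n m : ℤ) :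
    wave p q c r n (m + 1) = wave p q c r n m * lin (-q) := by
  rw [wave, wave, taylor_zpow_succ hq]
  ring

/-- The plane wave divided by `p ^ n q ^ m`, with coefficients polynomial in `(n, m)`. -/
def polyWave (p q c : ℂ) (r : ℂ → ℂ) : PowerSeries (MvPolynomial (Fin 2) ℂ) :=
  binomSeries p 0 * binomSeries q 1 *
    PowerSeries.map MvPolynomial.C (taylor fun k => r (c + k))

theorem wave_eq_map (hp : p ≠ 0) (hq : q ≠ 0) (n m : ℤ) :
    wave p q c r n m = PowerSeries.C (p ^ n * q ^ m) *
      PowerSeries.map (MvPolynomial.eval ![(n : ℂ), (m : ℂ)]) (polyWave p q c r) := by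
  have e : PowerSeries.map (MvPolynomial.eval ![(n : ℂ), (m : ℂ)])
      (PowerSeries.map MvPolynomial.C (taylor fun k => r (c + k))) =
      taylor fun k => r (c + k) := by
    ext j
    simp
  rw [wave, polyWave, taylor_zpow_eq_map hp n 0 ![(n : ℂ), (m : ℂ)] (by simp),
    taylor_zpow_eq_map hq m 1 ![(n : ℂ), (m : ℂ)] (by simp), map_mul, map_mul, map_mul, e]
  ring

theorem taylor_wave {a b : ℂ} (hp : p ≠ 0) (hq : q ≠ 0) (hc : c ≠ 0) (ha : a ≠ 0) (hb : b ≠ 0)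
    (hr : AnalyticAt ℂ r c) (n m α β : ℤ) (l : ℕ) :
    taylor (fun k => (p + k) ^ n * (q + k) ^ m * (a + k) ^ α * (b + k) ^ β *
      ((c + k) ^ (l : ℤ) * r (c + k))) =
      wave p q c r n m * taylor (fun k => (a + k) ^ α) * taylor (fun k => (b + k) ^ β) *
        (PowerSeries.C c + PowerSeries.X) ^ l := by
  have hr' : AnalyticAt ℂ (fun k => r (c + k)) 0 :=
    AnalyticAt.fun_comp (by simpa using hr) (by fun_prop)
  have A12 := (analyticAt_const_add_zpow hp n).fun_mul (analyticAt_const_add_zpow hq m)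
  have A3 := analyticAt_const_add_zpow ha α
  have A4 := analyticAt_const_add_zpow hb β
  have A5 := analyticAt_const_add_zpow hc (l : ℤ)
  rw [taylor_mul ((A12.fun_mul A3).fun_mul A4) (A5.fun_mul hr'), taylor_mul (A12.fun_mul A3) A4,
    taylor_mul A12 A3,
    taylor_mul (analyticAt_const_add_zpow hp n) (analyticAt_const_add_zpow hq m),
    taylor_mul A5 hr', taylor_zpow_natCast hc, wave]
  generalize taylor (fun k => (a + k) ^ α) = T₁
  generalize taylor (fun k => (b + k) ^ β) = T₂
  generalize taylor (fun k => (p + k) ^ n) = T₃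
  generalize taylor (fun k => (q + k) ^ m) = T₄
  generalize taylor (fun k => r (c + k)) = T₅
  ring

/-- The substitution `k ↦ -k` fixes derivatives of even order at 0, so the value is the same for
both signs `σ`. -/
theorem phi_eq_coeff {a b : ℂ} (hp : p ≠ 0) (hq : q ≠ 0) (hc : c ≠ 0) (ha : a ≠ 0) (hb : b ≠ 0)
    (hr : AnalyticAt ℂ r c) {σ : ℂ} (hσ : σ = 1 ∨ σ = -1) (n m α β : ℤ) (l s : ℕ) :
    phi p q a b c r σ n m α β l s = PowerSeries.coeff (2 * s)
      (wave p q c r n m * taylor (fun k => (a + k) ^ α) * taylor (fun k => (b + k) ^ β) *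
        (PowerSeries.C c + PowerSeries.X) ^ l) := by
  rw [← taylor_wave hp hq hc ha hb hr, phi, taylor, PowerSeries.coeff_mk, one_div, div_eq_inv_mul]
  congr 1
  rcases hσ with rfl | rfl
  · simp only [one_mul, zpow_natCast]
  · have h := iteratedDeriv_comp_neg (2 * s) (fun k : ℂ => (p + k) ^ n * (q + k) ^ m *
      (a + k) ^ α * (b + k) ^ β * ((c + k) ^ (l : ℤ) * r (c + k))) 0
    rw [neg_zero, (even_two_mul s).neg_one_pow, one_smul] at h
    rw [← h]
    simp only [neg_one_mul, zpow_natCast]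

/-- As `φ⁺ = φ⁻`, the matrices act only through their sum, which factors out on the left;
`det_coeff_shift` removes `c` from the column powers. -/
theorem casoratian_eq_evenDet {N : ℕ} (Ap Am : Matrix (Fin N) (Fin N) ℂ) {a b : ℂ}
    (hp : p ≠ 0) (hq : q ≠ 0) (hc : c ≠ 0) (ha : a ≠ 0) (hb : b ≠ 0)
    (hr : AnalyticAt ℂ r c) (n m α β : ℤ) :
    casoratian Ap Am p q a b c r n m α β = (Ap + Am).det * evenDet N
      (wave p q c r n m * taylor (fun k => (a + k) ^ α) * taylor (fun k => (b + k) ^ β)) := by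
  rw [← det_coeff_shift N c, ← Matrix.det_mul, casoratian]
  congr 1
  ext i l
  simp only [Matrix.of_apply, Phi, Pi.add_apply, Matrix.mulVec, dotProduct, Matrix.mul_apply,
    phi_eq_coeff hp hq hc ha hb hr (Or.inl rfl), phi_eq_coeff hp hq hc ha hb hr (Or.inr rfl),
    Matrix.add_apply, add_mul, Finset.sum_add_distrib]

theorem fCas_eq_evenDet {N : ℕ} (Ap Am : Matrix (Fin N) (Fin N) ℂ)
    (hp : p ≠ 0) (hq : q ≠ 0) (hc : c ≠ 0) (hr : AnalyticAt ℂ r c) (n m : ℤ) :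
    fCas Ap Am p q c r n m = (Ap + Am).det * evenDet N (wave p q c r n m) := by
  rw [fCas, casoratian_eq_evenDet Ap Am hp hq hc one_ne_zero one_ne_zero hr, taylor_zpow_zero,
    mul_one, mul_one]

theorem evenDet_lin_lin_of_mul_eq {N : ℕ} {a b : ℂ} (ha : a ≠ 0) (hb : b ≠ 0)
    (W T U : PowerSeries ℂ)
    (hT : T * (PowerSeries.C (a ^ 2) - PowerSeries.X ^ 2) = PowerSeries.C (-1) * lin a)
    (hU : U * (PowerSeries.C (b ^ 2) - PowerSeries.X ^ 2) = PowerSeries.C (-1) * lin b) :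
    evenDet N (W * lin a * lin b) = a ^ (2 * N) * (b ^ (2 * N) * evenDet N (W * T * U)) := by
  rw [← evenDet_mul_sq_sub N _ hb, ← evenDet_mul_sq_sub N _ ha]
  have h : PowerSeries.C (-1 : ℂ) * PowerSeries.C (-1) = 1 := by
    rw [← map_mul]
    simp
  have e : W * lin a * lin b =
      W * (PowerSeries.C (-1) * lin a) * (PowerSeries.C (-1) * lin b) := by
    linear_combination -W * lin a * lin b * h
  rw [e, ← hT, ← hU]
  ring_nf

theorem vartheta_eq_evenDet {N : ℕ} (Ap Am : Matrix (Fin N) (Fin N) ℂ) {a b : ℂ}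
    (hp : p ≠ 0) (hq : q ≠ 0) (hc : c ≠ 0) (ha : a ≠ 0) (hb : b ≠ 0)
    (hr : AnalyticAt ℂ r c) (n m : ℤ) :
    vartheta Ap Am p q c r a b n m = (Ap + Am).det *
      (((a * b) ^ N)⁻¹ * evenDet N (wave p q c r n m * lin a * lin b)) := by
  rw [vartheta, casoratian_eq_evenDet Ap Am hp hq hc ha hb hr]
  rw [evenDet_lin_lin_of_mul_eq ha hb _ _ _ (lin_mul_taylor_zpow_neg_one ha)
    (lin_mul_taylor_zpow_neg_one hb)]
  generalize evenDet (R := ℂ) N _ = z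
  field_simp
  ring

end PlaneWave

/-! ### NQC and Q3 as consequences of the edge relation. -/

section Algebra

/-- The basic relation `1 - (t + b) S̃(a, b) + (t - a) S(a, b) = Ṽ(a) V(b)` along a lattice edge
with lattice parameter `t`. -/
def EdgeRelation (t : ℂ) (T T' : ℂ → ℂ → ℂ) (V V' : ℂ → ℂ) : Prop :=
  ∀ a b : ℂ, a ≠ 0 → b ≠ 0 → 1 - (t + b) * T' a b + (t - a) * T a b = V' a * V b

/-- Symmetry of `S(a, b)` in its parameters. -/
def SymmetricOn (T : ℂ → ℂ → ℂ) : Prop :=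
  ∀ a b : ℂ, a ≠ 0 → b ≠ 0 → T a b = T b a

/-- Both sides equal the product of `V(b)`, `Ṽ(a)`, `V̂(a)` and the doubly shifted `V(b)`. Symmetry
lets the edges through the far vertex be used with `a` and `b` exchanged. -/
theorem nqc_of_edgeRelation {p q a b : ℂ} (ha : a ≠ 0) (hb : b ≠ 0)
    {T : ℂ → ℂ → ℤ → ℤ → ℂ} {V : ℂ → ℤ → ℤ → ℂ} {n m : ℤ}
    (s₁ : SymmetricOn fun x y => T x y (n + 1) m) (s₂ : SymmetricOn fun x y => T x y n (m + 1))
    (s₁₂ : SymmetricOn fun x y => T x y (n + 1) (m + 1))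
    (h₁ : EdgeRelation p (fun x y => T x y n m) (fun x y => T x y (n + 1) m)
      (fun x => V x n m) fun x => V x (n + 1) m)
    (h₂ : EdgeRelation q (fun x y => T x y n m) (fun x y => T x y n (m + 1))
      (fun x => V x n m) fun x => V x n (m + 1))
    (h₁₂ : EdgeRelation q (fun x y => T x y (n + 1) m) (fun x y => T x y (n + 1) (m + 1))
      (fun x => V x (n + 1) m) fun x => V x (n + 1) (m + 1))
    (h₂₁ : EdgeRelation p (fun x y => T x y n (m + 1)) (fun x y => T x y (n + 1) (m + 1))
      (fun x => V x n (m + 1)) fun x => V x (n + 1) (m + 1)) :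
    NQC p q a b (T a b) n m := by
  have e₁ := h₁ a b ha hb
  have e₂ := h₂ a b ha hb
  have e₁₂ := h₁₂ b a hb ha
  have e₂₁ := h₂₁ b a hb ha
  have k₁ := s₁ a b ha hb
  have k₂ := s₂ a b ha hb
  have k₁₂ := s₁₂ a b ha hb
  simp only at e₁ e₂ e₁₂ e₂₁ k₁ k₂ k₁₂
  rw [← k₁, ← k₁₂] at e₁₂
  rw [← k₂, ← k₁₂] at e₂₁
  rw [NQC]
  rw [show 1 + (p - a) * T a b n m - (p + b) * T a b (n + 1) m = V a (n + 1) m * V b n m by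
      rw [← e₁]; ring,
    show 1 - (p + a) * T a b (n + 1) (m + 1) + (p - b) * T a b n (m + 1) =
      V b (n + 1) (m + 1) * V a n (m + 1) by rw [← e₂₁],
    show 1 - (q + a) * T a b (n + 1) (m + 1) + (q - b) * T a b (n + 1) m =
      V b (n + 1) (m + 1) * V a (n + 1) m by rw [← e₁₂],
    show 1 + (q - a) * T a b n m - (q + b) * T a b n (m + 1) = V a n (m + 1) * V b n m by
      rw [← e₂]; ring]
  ring

/-- The evolution of the phase factors `g(±a)` along an edge with lattice parameter `t`, where
`w ^ 2 = t ^ 2 - a ^ 2`. -/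
structure PhaseRelation (t w a : ℂ) (g g' : ℂ → ℂ) : Prop where
  fwd : (t - a) * g' a = w * g a
  bwd : w * g' a = (t + a) * g a
  fwd_neg : (t + a) * g' (-a) = w * g (-a)
  bwd_neg : w * g' (-a) = (t - a) * g (-a)

theorem PhaseRelation.neg {t w a : ℂ} {g g' : ℂ → ℂ} (h : PhaseRelation t w a g g') :
    PhaseRelation t w (-a) g g' where
  fwd := by rw [sub_neg_eq_add]; exact h.fwd_neg
  bwd := by rw [h.bwd_neg]; ring
  fwd_neg := by rw [neg_neg, ← sub_eq_add_neg]; exact h.fwd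
  bwd_neg := by rw [neg_neg, h.bwd]; ring

/-- The bilinear form with matrix `[[A(a+b), B(a-b)], [C(-a+b), D(-a-b)]]`. -/
def coupling (a b A B C D x₁ x₂ y₁ y₂ : ℂ) : ℂ :=
  A * (a + b) * x₁ * y₁ + B * (a - b) * x₁ * y₂ + C * (-a + b) * x₂ * y₁ + D * (-a - b) * x₂ * y₂

/-- The coupling of `g V` at `±a` with `h U` at `±b`. -/
def phaseCoupling (a b A B C D : ℂ) (g V h U : ℂ → ℂ) : ℂ :=
  coupling a b A B C D (g a * V a) (g (-a) * V (-a)) (h b * U b) (h (-b) * U (-b))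

/-- The combination `u` at one lattice site. -/
def siteSol (a b A B C D : ℂ) (g h : ℂ → ℂ) (T : ℂ → ℂ → ℂ) : ℂ :=
  A * (g a * h b) * (1 - (a + b) * T a b) + B * (g a * h (-b)) * (1 - (a - b) * T a (-b)) +
    C * (g (-a) * h b) * (1 + (a - b) * T (-a) b) +
    D * (g (-a) * h (-b)) * (1 + (a + b) * T (-a) (-b))

section Edge

variable {t wa wb a b : ℂ} {g g' h h' V V' : ℂ → ℂ} {T T' : ℂ → ℂ → ℂ}

/-- The edge relation at `(b, a)`, rewritten by symmetry, puts the shifted `V` at `b`. The backward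
version uses it at `(a, b)`, so the shift falls on `a`. -/
theorem edge_term_forward (ha : a ≠ 0) (hb : b ≠ 0) (hg : PhaseRelation t wa a g g')
    (hh : PhaseRelation t wb b h h') (hT : SymmetricOn T) (hT' : SymmetricOn T')
    (hE : EdgeRelation t T T' V V') :
    wa * wb * (g' a * h' b) * (1 - (a + b) * T' a b) -
        (t ^ 2 - b ^ 2) * (g a * h b) * (1 - (a + b) * T a b) =
      wb * ((a + b) * (g a * V a) * (h' b * V' b)) := by
  have e := hE b a hb ha
  rw [← hT a b ha hb, ← hT' a b ha hb] at e
  linear_combination wb * h' b * (1 - (a + b) * T' a b) * hg.bwd +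
    g a * ((t + a) * (1 - (a + b) * T' a b) - (a + b) * V a * V' b) * hh.bwd +
    (a + b) * (t + b) * g a * h b * e

theorem edge_term_backward (ha : a ≠ 0) (hb : b ≠ 0) (hg : PhaseRelation t wa a g g')
    (hh : PhaseRelation t wb b h h')
    (hE : EdgeRelation t T T' V V') :
    (t ^ 2 - b ^ 2) * (g' a * h' b) * (1 - (a + b) * T' a b) -
        wa * wb * (g a * h b) * (1 - (a + b) * T a b) =
      wb * ((a + b) * (g' a * V' a) * (h b * V b)) := by
  have e := hE a b ha hb
  linear_combination (t + b) * g' a * (1 - (a + b) * T' a b) * hh.fwd +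
    wb * h b * (1 - (a + b) * T a b) * hg.fwd + (a + b) * wb * g' a * h b * e

theorem edge_forward (A B C D : ℂ) (ha : a ≠ 0) (hb : b ≠ 0) (hg : PhaseRelation t wa a g g')
    (hh : PhaseRelation t wb b h h') (hT : SymmetricOn T) (hT' : SymmetricOn T')
    (hE : EdgeRelation t T T' V V') :
    wa * wb * siteSol a b A B C D g' h' T' - (t ^ 2 - b ^ 2) * siteSol a b A B C D g h T =
      wb * phaseCoupling a b A B C D g V h' V' := by
  have e₁ := edge_term_forward ha hb hg hh hT hT' hE
  have e₂ := edge_term_forward ha (neg_ne_zero.mpr hb) hg hh.neg hT hT' hE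
  have e₃ := edge_term_forward (neg_ne_zero.mpr ha) hb hg.neg hh hT hT' hE
  have e₄ := edge_term_forward (neg_ne_zero.mpr ha) (neg_ne_zero.mpr hb) hg.neg hh.neg hT hT' hE
  simp only [siteSol, phaseCoupling, coupling]
  linear_combination A * e₁ + B * e₂ + C * e₃ + D * e₄

theorem edge_backward (A B C D : ℂ) (ha : a ≠ 0) (hb : b ≠ 0) (hg : PhaseRelation t wa a g g')
    (hh : PhaseRelation t wb b h h') (hE : EdgeRelation t T T' V V') :
    (t ^ 2 - b ^ 2) * siteSol a b A B C D g' h' T' - wa * wb * siteSol a b A B C D g h T =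
      wb * phaseCoupling a b A B C D g' V' h V := by
  have e₁ := edge_term_backward ha hb hg hh hE
  have e₂ := edge_term_backward ha (neg_ne_zero.mpr hb) hg hh.neg hE
  have e₃ := edge_term_backward (neg_ne_zero.mpr ha) hb hg.neg hh hE
  have e₄ := edge_term_backward (neg_ne_zero.mpr ha) (neg_ne_zero.mpr hb) hg.neg hh.neg hE
  simp only [siteSol, phaseCoupling, coupling]
  linear_combination A * e₁ + B * e₂ + C * e₃ + D * e₄

/-- The Wronskian-type bracket of neighbouring sites is constant. -/
theorem edge_bracket (ha : a ≠ 0) (hg : PhaseRelation t wa a g g')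
    (hgg : g a * g (-a) = 1) (hT : SymmetricOn T) (hT' : SymmetricOn T')
    (hE : EdgeRelation t T T' V V') :
    wa * ((g a * V a) * (g' (-a) * V' (-a)) - (g (-a) * V (-a)) * (g' a * V' a)) = -2 * a := by
  have ha' := neg_ne_zero.mpr ha
  have e₁ := hE a (-a) ha ha'
  have e₂ := hE (-a) a ha' ha
  rw [← hT a (-a) ha ha', ← hT' a (-a) ha ha'] at e₂
  -- Weighting the two edge relations by `t - a` and `t + a` cancels `T` and `T'`, leaving `(t - a)
  -- - (t + a) = -2a`.
  linear_combination g a * V a * V' (-a) * hg.bwd_neg - g (-a) * V (-a) * V' a * hg.bwd +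
    ((t - a) * V a * V' (-a) - (t + a) * V (-a) * V' a) * hgg - (t - a) * e₂ + (t + a) * e₁

end Edge

/-- The algebraic core: the lattice equation follows from the edge relations of `u` and the
Plücker relations between the two-vectors at the four vertices. -/
theorem q3_of_coupling {p q a b A B C D δ pa pb qa qb : ℂ} (ha : a ≠ 0) (hb : b ≠ 0)
    (hpa : pa ^ 2 = p ^ 2 - a ^ 2) (hpb : pb ^ 2 = p ^ 2 - b ^ 2)
    (hqa : qa ^ 2 = q ^ 2 - a ^ 2) (hqb : qb ^ 2 = q ^ 2 - b ^ 2)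
    (hpa0 : pa ≠ 0) (hpb0 : pb ≠ 0) (hqa0 : qa ≠ 0) (hqb0 : qb ≠ 0)
    (hABCD : A * D * (a + b) ^ 2 - B * C * (a - b) ^ 2 = -(δ ^ 2 / (16 * a * b)))
    {x x' x₁ x₁' y y' y₁ y₁' y₂ y₂' y₃ y₃' u u₁ u₂ u₃ : ℂ}
    (hx : pa * (x * x₁' - x' * x₁) = -2 * a)
    (hy01 : pb * (y * y₁' - y' * y₁) = -2 * b) (hy23 : pb * (y₂ * y₃' - y₂' * y₃) = -2 * b)
    (hy02 : qb * (y * y₂' - y' * y₂) = -2 * b) (hy13 : qb * (y₁ * y₃' - y₁' * y₃) = -2 * b)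
    (e01 : pa * pb * u₁ - (p ^ 2 - b ^ 2) * u = pb * coupling a b A B C D x x' y₁ y₁')
    (e02 : qa * qb * u₂ - (q ^ 2 - b ^ 2) * u = qb * coupling a b A B C D x x' y₂ y₂')
    (e10 : (p ^ 2 - b ^ 2) * u₁ - pa * pb * u = pb * coupling a b A B C D x₁ x₁' y y')
    (e13 : qa * qb * u₃ - (q ^ 2 - b ^ 2) * u₁ = qb * coupling a b A B C D x₁ x₁' y₃ y₃') :
    pa * pb * (u * u₂ + u₁ * u₃) - qa * qb * (u * u₁ + u₂ * u₃) =
      (p ^ 2 - q ^ 2) * ((u₁ * u₂ + u * u₃) + δ ^ 2 / (4 * (pa * pb) * (qa * qb))) := by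
  -- Three vectors in a plane are linearly dependent, with their brackets as coefficients. Edge
  -- brackets are constants, so only the diagonal bracket, normalised as `ν`, survives in the four
  -- relations below.
  set ν : ℂ := pb * qb * (y₁ * y₂' - y₁' * y₂) / (2 * b) with hν
  have hν' : 2 * b * ν = pb * qb * (y₁ * y₂' - y₁' * y₂) := by rw [hν]; field_simp
  have b2 : (2 * b) ≠ 0 := mul_ne_zero two_ne_zero hb
  have hy : ν * y = qb * y₂ - pb * y₁ := by
    apply mul_left_cancel₀ b2
    linear_combination y * hν' + pb * y₁ * hy02 - qb * y₂ * hy01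
  have hy' : ν * y' = qb * y₂' - pb * y₁' := by
    apply mul_left_cancel₀ b2
    linear_combination y' * hν' + pb * y₁' * hy02 - qb * y₂' * hy01
  have hz : ν * y₃ = qb * y₁ - pb * y₂ := by
    apply mul_left_cancel₀ b2
    linear_combination y₃ * hν' - qb * y₁ * hy23 + pb * y₂ * hy13
  have hz' : ν * y₃' = qb * y₁' - pb * y₂' := by
    apply mul_left_cancel₀ b2
    linear_combination y₃' * hν' - qb * y₁' * hy23 + pb * y₂' * hy13
  -- Plücker relation for all four vectors: the product of the two diagonal brackets is fixed by the
  -- edge brackets.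
  have hpl : pb * qb * (ν * (y * y₃' - y' * y₃)) = 2 * b * (p ^ 2 - q ^ 2) := by
    apply mul_left_cancel₀ b2
    have : pb ^ 2 * qb ^ 2 * ((y₁ * y₂' - y₁' * y₂) * (y * y₃' - y' * y₃)) =
        4 * b ^ 2 * (pb ^ 2 - qb ^ 2) := by
      linear_combination qb ^ 2 * (-(pb * (y₂ * y₃' - y₂' * y₃)) * hy01 + 2 * b * hy23) +
        pb ^ 2 * (qb * (y₁ * y₃' - y₁' * y₃) * hy02 - 2 * b * hy13)
    linear_combination pb * qb * (y * y₃' - y' * y₃) * hν' + this + 4 * b ^ 2 * (hpb - hqb)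
  -- A 2×2 minor of a bilinear form is its determinant times both brackets; the constraint on `A, B,
  -- C, D` makes that determinant `δ²/(16ab)`.
  have hdet : coupling a b A B C D x x' y y' * coupling a b A B C D x₁ x₁' y₃ y₃' -
      coupling a b A B C D x x' y₃ y₃' * coupling a b A B C D x₁ x₁' y y' =
      δ ^ 2 / (16 * a * b) * ((x * x₁' - x' * x₁) * (y * y₃' - y' * y₃)) := by
    rw [← neg_eq_iff_eq_neg] at hABCD
    rw [← hABCD]
    simp only [coupling]
    ring
  have hw : ν * coupling a b A B C D x x' y y' =
      (p ^ 2 - q ^ 2) * u - pa * pb * u₁ + qa * qb * u₂ := by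
    have : ν * coupling a b A B C D x x' y y' = qb * coupling a b A B C D x x' y₂ y₂' -
        pb * coupling a b A B C D x x' y₁ y₁' := by
      simp only [coupling]
      linear_combination (A * (a + b) * x + C * (-a + b) * x') * hy +
        (B * (a - b) * x + D * (-a - b) * x') * hy'
    rw [this, ← e01, ← e02]
    ring
  have hw₃ : ν * coupling a b A B C D x x' y₃ y₃' =
      qb * coupling a b A B C D x x' y₁ y₁' - pb * coupling a b A B C D x x' y₂ y₂' := by
    simp only [coupling]
    linear_combination (A * (a + b) * x + C * (-a + b) * x') * hz +
        (B * (a - b) * x + D * (-a - b) * x') * hz'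
  generalize coupling a b A B C D x x' y y' = w at *
  generalize coupling a b A B C D x₁ x₁' y₃ y₃' = c₁₃ at *
  generalize coupling a b A B C D x x' y₃ y₃' = c₀₃ at *
  generalize coupling a b A B C D x₁ x₁' y y' = c₁₀ at *
  generalize coupling a b A B C D x x' y₁ y₁' = c₀₁ at *
  generalize coupling a b A B C D x x' y₂ y₂' = c₀₂ at *
  set L : ℂ := (p ^ 2 - q ^ 2) * u - pa * pb * u₁ + qa * qb * u₂ with hL
  -- The same minor is now computed twice: here through the values of `u`, and in `hrhs` through the
  -- constant brackets.
  have hlhs : pb ^ 2 * qb * (ν * (w * c₁₃ - c₀₃ * c₁₀)) =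
      pb ^ 2 * L * (qa * qb * u₃ - (q ^ 2 - b ^ 2) * u₁) -
        (qb ^ 2 * (pa * pb * u₁ - (p ^ 2 - b ^ 2) * u) -
          pb ^ 2 * (qa * qb * u₂ - (q ^ 2 - b ^ 2) * u)) *
          ((p ^ 2 - b ^ 2) * u₁ - pa * pb * u) := by
    rw [e13, e01, e02, e10]
    linear_combination pb ^ 2 * qb * c₁₃ * hw - pb ^ 2 * qb * c₁₀ * hw₃
  have hrhs : pa * (pb ^ 2 * qb * (ν * (w * c₁₃ - c₀₃ * c₁₀))) =
      -(pb * (p ^ 2 - q ^ 2) * (δ ^ 2 / 4)) := by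
    have : δ ^ 2 / (16 * a * b) * (-2 * a) * (2 * b) = -(δ ^ 2 / 4) := by
      field_simp
      ring
    rw [hdet]
    linear_combination δ ^ 2 / (16 * a * b) *
      (pb * (pb * qb * (ν * (y * y₃' - y' * y₃))) * hx + pb * (-2 * a) * hpl) +
        pb * (p ^ 2 - q ^ 2) * this
  set E : ℂ := pa * pb * (u * u₂ + u₁ * u₃) - qa * qb * (u * u₁ + u₂ * u₃) -
    (p ^ 2 - q ^ 2) * (u₁ * u₂ + u * u₃) with hE
  have hmain : pb ^ 2 * L * (qa * qb * u₃ - (q ^ 2 - b ^ 2) * u₁) -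
        (qb ^ 2 * (pa * pb * u₁ - (p ^ 2 - b ^ 2) * u) -
          pb ^ 2 * (qa * qb * u₂ - (q ^ 2 - b ^ 2) * u)) *
          ((p ^ 2 - b ^ 2) * u₁ - pa * pb * u) = -(pb ^ 2 * (qa * qb) * E) := by
    rw [← hpb, ← hqb, hE, hL, show p ^ 2 - q ^ 2 = pb ^ 2 - qb ^ 2 by rw [hpb, hqb]; ring]
    -- Both `pa² - pb²` and `qa² - qb²` equal `b² - a²`, which removes the leftover `u * u₁` term.
    have : pa ^ 2 - pb ^ 2 - qa ^ 2 + qb ^ 2 = 0 := by rw [hpa, hpb, hqa, hqb]; ring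
    linear_combination pb ^ 2 * qb ^ 2 * u * u₁ * this
  have hfin : 4 * (pa * pb) * (qa * qb) * E = (p ^ 2 - q ^ 2) * δ ^ 2 := by
    rw [hlhs, hmain] at hrhs
    apply mul_left_cancel₀ hpb0
    linear_combination -4 * hrhs
  have hne : 4 * (pa * pb) * (qa * qb) ≠ 0 := by simp [hpa0, hpb0, hqa0, hqb0]
  have hfin' : E = (p ^ 2 - q ^ 2) * (δ ^ 2 / (4 * (pa * pb) * (qa * qb))) := by
    rw [← mul_div_assoc, eq_div_iff hne, ← hfin]
    ring
  linear_combination hfin'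

/-- The phase factor whose values at `a` and `b` multiply to `F(a, b)`. -/
def phase (p q w v : ℂ) (n m : ℤ) (x : ℂ) : ℂ :=
  (w / (p - x)) ^ n * (v / (q - x)) ^ m

section Phase

variable {p q w v a : ℂ}

/-- Since `w² = (p - a)(p + a)`, the step factor `w / (p - a)` is also `(p + a) / w`. Here `z` is
the phase of the other lattice direction, constant along the edge. -/
theorem phaseRelation_zpow_succ (hw : w ^ 2 = p ^ 2 - a ^ 2) (hw0 : w ≠ 0) (n : ℤ)
    (z : ℂ → ℂ) : PhaseRelation p w a (fun x => (w / (p - x)) ^ n * z x)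
      fun x => (w / (p - x)) ^ (n + 1) * z x := by
  have h : (p - a) * (p + a) ≠ 0 := by
    rw [show (p - a) * (p + a) = w ^ 2 by rw [hw]; ring]
    exact pow_ne_zero 2 hw0
  have h1 := left_ne_zero_of_mul h
  have h2 := right_ne_zero_of_mul h
  have h3 : w / (p - a) ≠ 0 := div_ne_zero hw0 h1
  have h4 : w / (p + a) ≠ 0 := div_ne_zero hw0 h2
  have e1 : (p - a) * (w / (p - a)) = w := by field_simp
  have e2 : (p + a) * (w / (p + a)) = w := by field_simp
  have e3 : w * (w / (p - a)) = p + a := by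
    rw [← mul_div_assoc, div_eq_iff h1]
    linear_combination hw
  have e4 : w * (w / (p + a)) = p - a := by
    rw [← mul_div_assoc, div_eq_iff h2]
    linear_combination hw
  refine ⟨?_, ?_, ?_, ?_⟩ <;> try rw [sub_neg_eq_add]
  · rw [zpow_add_one₀ h3]
    linear_combination (w / (p - a)) ^ n * z a * e1
  · rw [zpow_add_one₀ h3]
    linear_combination (w / (p - a)) ^ n * z a * e3
  · rw [zpow_add_one₀ h4]
    linear_combination (w / (p + a)) ^ n * z (-a) * e2
  · rw [zpow_add_one₀ h4]
    linear_combination (w / (p + a)) ^ n * z (-a) * e4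

theorem phaseRelation_left (hw : w ^ 2 = p ^ 2 - a ^ 2) (hw0 : w ≠ 0) (n m : ℤ) :
    PhaseRelation p w a (phase p q w v n m) (phase p q w v (n + 1) m) :=
  phaseRelation_zpow_succ hw hw0 n fun x => (v / (q - x)) ^ m

theorem phaseRelation_right (hv : v ^ 2 = q ^ 2 - a ^ 2) (hv0 : v ≠ 0) (n m : ℤ) :
    PhaseRelation q v a (phase p q w v n m) (phase p q w v n (m + 1)) := by
  have h := phaseRelation_zpow_succ hv hv0 m fun x => (w / (p - x)) ^ n
  simp only [mul_comm _ ((w / (p - _)) ^ n)] at h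
  exact h

theorem phase_mul_phase_neg (hw : w ^ 2 = p ^ 2 - a ^ 2) (hw0 : w ≠ 0)
    (hv : v ^ 2 = q ^ 2 - a ^ 2) (hv0 : v ≠ 0) (n m : ℤ) :
    phase p q w v n m a * phase p q w v n m (-a) = 1 := by
  have key : ∀ {t y : ℂ}, y ^ 2 = t ^ 2 - a ^ 2 → y ≠ 0 →
      y / (t - a) * (y / (t - -a)) = 1 := fun {t y} h h0 => by
    have h' : (t - a) * (t - -a) = y ^ 2 := by rw [h]; ring
    rw [div_mul_div_comm, h', ← sq, div_self (pow_ne_zero 2 h0)]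
  rw [phase, phase, mul_mul_mul_comm, ← mul_zpow, ← mul_zpow, key hw hw0, key hv hv0]
  simp

theorem phase_mul_phase (p q w v w' v' x y : ℂ) (n m : ℤ) :
    phase p q w v n m x * phase p q w' v' n m y = F p (w * w') q (v * v') x y n m := by
  rw [phase, phase, F, mul_mul_mul_comm, ← mul_zpow, ← mul_zpow, div_mul_div_comm,
    div_mul_div_comm]

end Phase

theorem uSol_eq_siteSol (p q w v w' v' a b A B C D : ℂ) (T : ℂ → ℂ → ℤ → ℤ → ℂ) (n m : ℤ) :
    uSol p (w * w') q (v * v') a b A B C D T n m =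
      siteSol a b A B C D (phase p q w v n m) (phase p q w' v' n m) fun x y => T x y n m := by
  simp only [uSol, siteSol, phase_mul_phase]

/-- Any root `w` of `s` will do, and `w' = P / w` then matches the prescribed sign of `P`; this
splits `F(a, b)` into a phase in `a` and a phase in `b`. -/
theorem exists_sq_factor {P s t : ℂ} (hP : P ^ 2 = s * t) (hP0 : P ≠ 0) :
    ∃ w w' : ℂ, w ≠ 0 ∧ w' ≠ 0 ∧ w ^ 2 = s ∧ w' ^ 2 = t ∧ P = w * w' := by
  have hst : s * t ≠ 0 := hP ▸ pow_ne_zero 2 hP0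
  have hs := left_ne_zero_of_mul hst
  obtain ⟨w, hw⟩ := IsAlgClosed.exists_pow_nat_eq s two_pos
  have hw0 : w ≠ 0 := by
    rintro rfl
    exact hs (by rw [← hw]; simp)
  refine ⟨w, P / w, hw0, div_ne_zero hP0 hw0, hw, ?_, by field_simp⟩
  rw [div_pow, hP, hw, mul_div_cancel_left₀ _ hs]

theorem q3_of_edgeRelation {p P q Q a b A B C D δ : ℂ} (ha : a ≠ 0) (hb : b ≠ 0)
    (hP : P ^ 2 = (p ^ 2 - a ^ 2) * (p ^ 2 - b ^ 2))
    (hQ : Q ^ 2 = (q ^ 2 - a ^ 2) * (q ^ 2 - b ^ 2)) (hP0 : P ≠ 0) (hQ0 : Q ≠ 0)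
    (hABCD : A * D * (a + b) ^ 2 - B * C * (a - b) ^ 2 = -(δ ^ 2 / (16 * a * b)))
    {T : ℂ → ℂ → ℤ → ℤ → ℂ} {V : ℂ → ℤ → ℤ → ℂ} {n m : ℤ}
    (s : SymmetricOn fun x y => T x y n m)
    (s₁ : SymmetricOn fun x y => T x y (n + 1) m) (s₂ : SymmetricOn fun x y => T x y n (m + 1))
    (s₁₂ : SymmetricOn fun x y => T x y (n + 1) (m + 1))
    (h₁ : EdgeRelation p (fun x y => T x y n m) (fun x y => T x y (n + 1) m)
      (fun x => V x n m) fun x => V x (n + 1) m)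
    (h₂ : EdgeRelation q (fun x y => T x y n m) (fun x y => T x y n (m + 1))
      (fun x => V x n m) fun x => V x n (m + 1))
    (h₁₂ : EdgeRelation q (fun x y => T x y (n + 1) m) (fun x y => T x y (n + 1) (m + 1))
      (fun x => V x (n + 1) m) fun x => V x (n + 1) (m + 1))
    (h₂₁ : EdgeRelation p (fun x y => T x y n (m + 1)) (fun x y => T x y (n + 1) (m + 1))
      (fun x => V x n (m + 1)) fun x => V x (n + 1) (m + 1)) :
    Q3 p P q Q δ (uSol p P q Q a b A B C D T) n m := by
  obtain ⟨pa, pb, hpa0, hpb0, hpa, hpb, rfl⟩ := exists_sq_factor hP hP0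
  obtain ⟨qa, qb, hqa0, hqb0, hqa, hqb, rfl⟩ := exists_sq_factor hQ hQ0
  have ga := fun n m => phaseRelation_left (q := q) (v := qa) hpa hpa0 n m
  have gb := fun n m => phaseRelation_left (q := q) (v := qb) hpb hpb0 n m
  have ga' := fun n m => phaseRelation_right (p := p) (w := pa) hqa hqa0 n m
  have gb' := fun n m => phaseRelation_right (p := p) (w := pb) hqb hqb0 n m
  have ia := phase_mul_phase_neg hpa hpa0 hqa hqa0
  have ib := phase_mul_phase_neg hpb hpb0 hqb hqb0
  have bx := edge_bracket ha (ga n m) (ia n m) s s₁ h₁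
  have b01 := edge_bracket hb (gb n m) (ib n m) s s₁ h₁
  have b23 := edge_bracket hb (gb n (m + 1)) (ib n (m + 1)) s₂ s₁₂ h₂₁
  have b02 := edge_bracket hb (gb' n m) (ib n m) s s₂ h₂
  have b13 := edge_bracket hb (gb' (n + 1) m) (ib (n + 1) m) s₁ s₁₂ h₁₂
  have e01 := edge_forward A B C D ha hb (ga n m) (gb n m) s s₁ h₁
  have e02 := edge_forward A B C D ha hb (ga' n m) (gb' n m) s s₂ h₂
  have e10 := edge_backward A B C D ha hb (ga n m) (gb n m) h₁
  have e13 := edge_forward A B C D ha hb (ga' (n + 1) m) (gb' (n + 1) m) s₁ s₁₂ h₁₂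
  simp only [phaseCoupling] at bx b01 b23 b02 b13 e01 e02 e10 e13
  simp only [Q3, uSol_eq_siteSol]
  exact q3_of_coupling ha hb hpa hpb hqa hqb hpa0 hpb0 hqa0 hqb0 hABCD bx b01 b23 b02 b13
    e01 e02 e10 e13

end Algebra

/-! ### The edge relation and symmetry of `S`, including `b = -a`. -/

section Bridge

/-- The normalised determinant of `ϑ(a, b)` for the plane wave `W`. -/
def thetaDet (N : ℕ) (W : PowerSeries ℂ) (a b : ℂ) : ℂ :=
  ((a * b) ^ N)⁻¹ * evenDet N (W * lin a * lin b)

/-- `V(a)` for the plane wave `W`. -/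
def vval (N : ℕ) (W : PowerSeries ℂ) (a : ℂ) : ℂ :=
  (a ^ N)⁻¹ * evenDet N (W * lin a) / evenDet N W

/-- `S(a, b)` for the plane wave `W`. -/
def sval (N : ℕ) (W : PowerSeries ℂ) (a b : ℂ) : ℂ :=
  open Classical in
  (if a + b = 0 then -deriv (thetaDet N W a) b
    else -(1 / (a + b)) * (thetaDet N W a b - evenDet N W)) / evenDet N W

variable {N : ℕ} {W : PowerSeries ℂ} {a b : ℂ}

theorem thetaDet_comm (N : ℕ) (W : PowerSeries ℂ) (a b : ℂ) :
    thetaDet N W a b = thetaDet N W b a := by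
  rw [thetaDet, thetaDet, mul_comm a b, mul_assoc W, mul_comm (lin a), ← mul_assoc W]

theorem thetaDet_neg (N : ℕ) (W : PowerSeries ℂ) (ha : a ≠ 0) :
    thetaDet N W a (-a) = evenDet N W := by
  rw [thetaDet, evenDet_lin_lin_neg N _ ha, mul_neg, neg_pow]
  have : ((-1 : ℂ) ^ N) ≠ 0 := pow_ne_zero _ (by simp)
  generalize evenDet (R := ℂ) N _ = z
  field_simp
  ring

theorem differentiableAt_thetaDet (N : ℕ) (W : PowerSeries ℂ) (ha : a ≠ 0) (hb : b ≠ 0) :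
    DifferentiableAt ℂ (fun z : ℂ × ℂ => thetaDet N W z.1 z.2) (a, b) := by
  have h : ∀ k l (z : ℂ × ℂ),
      PowerSeries.coeff k (W * lin z.1 * lin z.2 * PowerSeries.X ^ l) =
        PowerSeries.coeff k (W * PowerSeries.X ^ (l + 2)) -
          (z.1 + z.2) * PowerSeries.coeff k (W * PowerSeries.X ^ (l + 1)) +
          z.1 * z.2 * PowerSeries.coeff k (W * PowerSeries.X ^ l) := fun k l z => by
    simp only [← PowerSeries.coeff_C_mul, ← map_sub, ← map_add, lin]
    congr 1
    simp only [map_add, map_mul]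
    ring
  have h1 : DifferentiableAt ℂ (fun z : ℂ × ℂ => evenDet N (W * lin z.1 * lin z.2)) (a, b) := by
    simp only [evenDet, Matrix.det_apply, Matrix.of_apply, h]
    fun_prop
  have h2 : DifferentiableAt ℂ (fun z : ℂ × ℂ => ((z.1 * z.2) ^ N)⁻¹) (a, b) :=
    DifferentiableAt.fun_inv (by fun_prop) (pow_ne_zero _ (mul_ne_zero ha hb))
  exact h2.fun_mul h1

theorem differentiableAt_thetaDet_right (N : ℕ) (W : PowerSeries ℂ) (ha : a ≠ 0) (hb : b ≠ 0) :
    DifferentiableAt ℂ (thetaDet N W a) b :=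
  (differentiableAt_thetaDet N W ha hb).comp b
    (f := fun x : ℂ => (a, x)) (by fun_prop)

/-- `thetaDet` is constant along the antidiagonal, so its derivative in the direction `(1, -1)`
vanishes and the two partials agree at `(a, -a)`. This gives symmetry of `S` at the removable
singularity. -/
theorem deriv_thetaDet_neg (N : ℕ) (W : PowerSeries ℂ) (ha : a ≠ 0) :
    deriv (thetaDet N W a) (-a) = deriv (thetaDet N W (-a)) a := by
  have hG := (differentiableAt_thetaDet N W ha (neg_ne_zero.mpr ha)).hasFDerivAt
  set G' := fderiv ℂ (fun z : ℂ × ℂ => thetaDet N W z.1 z.2) (a, -a)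
  have h1 : HasDerivAt (thetaDet N W a) (G' (0, 1)) (-a) :=
    hG.comp_hasDerivAt (-a) ((hasDerivAt_const (-a) a).prodMk (hasDerivAt_id (-a)))
  have h2 : HasDerivAt (thetaDet N W (-a)) (G' (1, 0)) a := by
    have := hG.comp_hasDerivAt a ((hasDerivAt_id a).prodMk (hasDerivAt_const a (-a)))
    exact this.congr_of_eventuallyEq (Eventually.of_forall fun x => thetaDet_comm N W (-a) x)
  have h3 : HasDerivAt (fun x => thetaDet N W x (-x)) (G' (1, -1)) a := by
    have h := (hasDerivAt_id' a).prodMk (hasDerivAt_neg' a)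
    exact HasFDerivAt.comp_hasDerivAt (f := fun x : ℂ => (x, -x)) a hG h
  have h4 : HasDerivAt (fun x => thetaDet N W x (-x)) 0 a := by
    refine (hasDerivAt_const a (evenDet N W)).congr_of_eventuallyEq ?_
    filter_upwards [isOpen_ne.mem_nhds ha] with x hx using thetaDet_neg N W hx
  have h5 := h3.unique h4
  rw [show ((1 : ℂ), (-1 : ℂ)) = (1, 0) - (0, 1) by simp, map_sub, sub_eq_zero] at h5
  rw [h1.deriv, h2.deriv, h5]

theorem symmetricOn_sval (N : ℕ) (W : PowerSeries ℂ) : SymmetricOn (sval N W) := by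
  intro a b ha _
  rw [sval, sval]
  congr 1
  by_cases h : a + b = 0
  · obtain rfl : b = -a := by linear_combination h
    rw [if_pos h, if_pos (by simp), deriv_thetaDet_neg N W ha]
  · rw [if_neg h, if_neg (by rwa [add_comm]), thetaDet_comm, add_comm a b]

theorem thetaDet_bilinear (N : ℕ) (W : PowerSeries ℂ) (ha : a ≠ 0) (b t : ℂ) :
    (t + b) * thetaDet N (W * lin (-t)) a b * evenDet N W -
        (t - a) * thetaDet N W a b * evenDet N (W * lin (-t)) =
      (a + b) * ((a ^ N)⁻¹ * evenDet N (W * lin (-t) * lin a)) *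
        ((b ^ N)⁻¹ * evenDet N (W * lin b)) := by
  have h := evenDet_bilinear N W ha b (-t)
  rw [thetaDet, thetaDet, mul_pow, mul_inv]
  linear_combination (a ^ N)⁻¹ * (b ^ N)⁻¹ * h

/-- Divide `thetaDet_bilinear` by `(a + b) f f̃`. At `b = -a` both of its sides vanish, and their
derivatives in `b` are compared instead. -/
theorem edgeRelation_sval (t : ℂ) (hf : evenDet N W ≠ 0) (hf' : evenDet N (W * lin (-t)) ≠ 0) :
    EdgeRelation t (sval N W) (sval N (W * lin (-t))) (vval N W) (vval N (W * lin (-t))) := by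
  intro a b ha hb
  by_cases h : a + b = 0
  · obtain rfl : b = -a := by linear_combination h
    have d := (differentiableAt_thetaDet_right N W ha hb).hasDerivAt
    have d' := (differentiableAt_thetaDet_right N (W * lin (-t)) ha hb).hasDerivAt
    have l := ((((hasDerivAt_id (-a)).const_add t).mul d').mul_const (evenDet N W)).sub
      ((d.const_mul (t - a)).mul_const (evenDet N (W * lin (-t))))
    have r : DifferentiableAt ℂ (fun x => (x ^ N)⁻¹ * evenDet N (W * lin x)) (-a) := by
      refine DifferentiableAt.fun_mul (DifferentiableAt.fun_inv (by fun_prop) (pow_ne_zero _ hb)) ?_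
      simp only [evenDet, Matrix.det_apply, Matrix.of_apply, ← coeff_mul_lin]
      fun_prop
    have r' := (((hasDerivAt_id (-a)).const_add a).mul_const
      ((a ^ N)⁻¹ * evenDet N (W * lin (-t) * lin a))).mul r.hasDerivAt
    have e := l.unique (r'.congr_of_eventuallyEq (by
      filter_upwards [isOpen_ne.mem_nhds hb] with x _ using thetaDet_bilinear N W ha x t))
    rw [sval, sval, if_pos h, if_pos h, vval, vval]
    simp only [id, thetaDet_neg N _ ha, add_neg_cancel, zero_mul, add_zero, one_mul] at e
    generalize (a ^ N)⁻¹ * evenDet N (W * lin (-t) * lin a) = z at e ⊢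
    generalize ((-a) ^ N)⁻¹ * evenDet N (W * lin (-a)) = z' at e ⊢
    field_simp
    linear_combination e
  · have e := thetaDet_bilinear N W ha b t
    rw [sval, sval, if_neg h, if_neg h, vval, vval]
    field_simp
    field_simp at e
    linear_combination e

end Bridge

/-! ### Transfer to the Casoratian `S`, and rationality. -/

section Main

variable {N : ℕ} {Ap Am : Matrix (Fin N) (Fin N) ℂ} {p q c a b : ℂ} {r : ℂ → ℂ}

/-- The common factor `det (Ap + Am)` cancels in the quotient; it is non-zero because `f` is. -/
theorem S_eq_sval (hp : p ≠ 0) (hq : q ≠ 0) (hc : c ≠ 0) (ha : a ≠ 0) (hb : b ≠ 0)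
    (hr : AnalyticAt ℂ r c) {n m : ℤ} (hf : fCas Ap Am p q c r n m ≠ 0) :
    S Ap Am p q c r a b n m = sval N (wave p q c r n m) a b := by
  have hth : ∀ x, x ≠ 0 → vartheta Ap Am p q c r a x n m =
      (Ap + Am).det * thetaDet N (wave p q c r n m) a x := fun x hx =>
    vartheta_eq_evenDet Ap Am hp hq hc ha hx hr n m
  have hff := fCas_eq_evenDet Ap Am hp hq hc hr n m
  rw [hff] at hf
  have hκ := left_ne_zero_of_mul hf
  have hd : deriv (fun x => vartheta Ap Am p q c r a x n m) b =
      (Ap + Am).det * deriv (thetaDet N (wave p q c r n m) a) b := by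
    rw [← deriv_const_mul_field]
    apply Filter.EventuallyEq.deriv_eq
    filter_upwards [isOpen_ne.mem_nhds hb] with x hx using hth x hx
  rw [S, sval, hd, hth b hb, hff]
  split_ifs
  · rw [← mul_neg, mul_div_mul_left _ _ hκ]
  · rw [← mul_sub, mul_left_comm, mul_div_mul_left _ _ hκ]

/-- `ϑ(a, x)` up to elementary factors, as a polynomial in `x`, over any coefficient ring. -/
def evenDetPoly {R : Type*} [CommRing R] (N : ℕ) (W : PowerSeries R) (a : R) : Polynomial R :=
  evenDet N (PowerSeries.map Polynomial.C W * lin (Polynomial.C a) * lin Polynomial.X)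

theorem map_lin {R T : Type*} [CommRing R] [CommRing T] (g : R →+* T) (x : R) :
    PowerSeries.map g (lin x) = lin (g x) := by
  simp [lin]

theorem eval_map_evenDetPoly {R : Type*} [CommRing R] (g : R →+* ℂ) (N : ℕ) (W : PowerSeries R)
    (a : R) (x : ℂ) :
    ((evenDetPoly N W a).map g).eval x =
      evenDet N (PowerSeries.map g W * lin (g a) * lin x) := by
  rw [← Polynomial.coe_evalRingHom, ← Polynomial.coe_mapRingHom, ← RingHom.comp_apply,
    evenDetPoly, map_evenDet]
  simp only [map_mul, map_lin]
  congr 3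
  · ext j
    simp
  · simp
  · simp

theorem hasDerivAt_thetaDet_of_poly {W : PowerSeries ℂ} (P : Polynomial ℂ)
    (hP : ∀ x, evenDet N (W * lin a * lin x) = P.eval x) (hb : b ≠ 0) :
    HasDerivAt (thetaDet N W a) ((a ^ N)⁻¹ * (-(N * b ^ (N - 1)) / (b ^ N) ^ 2 * P.eval b +
      (b ^ N)⁻¹ * P.derivative.eval b)) b := by
  have h := (((hasDerivAt_pow N b).fun_inv (pow_ne_zero N hb)).fun_mul
    (P.hasDerivAt b)).const_mul (a ^ N)⁻¹
  refine h.congr_of_eventuallyEq (Eventually.of_forall fun x => ?_)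
  simp only [thetaDet, hP]
  rw [mul_pow, mul_inv, mul_assoc]

theorem isRationalWhere_S (hp : p ≠ 0) (hq : q ≠ 0) (hc : c ≠ 0) (ha : a ≠ 0) (hb : b ≠ 0)
    (hr : AnalyticAt ℂ r c) :
    IsRationalWhere (fCas Ap Am p q c r) (S Ap Am p q c r a b) := by
  set 𝒲 := polyWave p q c r
  set Y : MvPolynomial (Fin 2) ℂ := evenDet N 𝒲 with hY
  set Θ : Polynomial (MvPolynomial (Fin 2) ℂ) := evenDetPoly N 𝒲 (MvPolynomial.C a)
  -- The only non-polynomial dependence on `(n, m)` is the scalar `μ = (p^n q^m)^N`, common to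
  -- numerator and denominator.
  have key : ∀ n m : ℤ, fCas Ap Am p q c r n m ≠ 0 →
      ∃ μ : ℂ, μ ≠ 0 ∧ evenDet N (wave p q c r n m) =
          μ * MvPolynomial.eval ![(n : ℂ), (m : ℂ)] Y ∧
        ∀ x, evenDet N (wave p q c r n m * lin a * lin x) =
          (Polynomial.C μ * Θ.map (MvPolynomial.eval ![(n : ℂ), (m : ℂ)])).eval x := by
    intro n m hf
    refine ⟨(p ^ n * q ^ m) ^ N, pow_ne_zero _ (mul_ne_zero (zpow_ne_zero _ hp)
      (zpow_ne_zero _ hq)), ?_, fun x => ?_⟩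
    · rw [wave_eq_map hp hq, evenDet_C_mul, hY, map_evenDet]
    · rw [Polynomial.eval_mul, Polynomial.eval_C, eval_map_evenDetPoly, ← evenDet_C_mul,
        wave_eq_map hp hq, MvPolynomial.eval_C]
      simp only [mul_assoc]
      rfl
  -- For `a + b = 0` the numerator copies the formula of `hasDerivAt_thetaDet_of_poly`:
  -- differentiating `Θ` in its own variable keeps coefficients polynomial in `(n, m)`.
  refine ⟨if a + b = 0 then -(MvPolynomial.C (a ^ N)⁻¹ *
      (MvPolynomial.C (-(N * b ^ (N - 1)) / (b ^ N) ^ 2) * Θ.eval (MvPolynomial.C b) +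
        MvPolynomial.C (b ^ N)⁻¹ * Θ.derivative.eval (MvPolynomial.C b)))
    else -MvPolynomial.C (1 / (a + b)) * (MvPolynomial.C ((a * b) ^ N)⁻¹ *
      Θ.eval (MvPolynomial.C b) - Y), Y, fun n m hf => ?_⟩
  obtain ⟨μ, hμ, hfY, hΘ⟩ := key n m hf
  have hev : ∀ P : Polynomial (MvPolynomial (Fin 2) ℂ),
      MvPolynomial.eval ![(n : ℂ), (m : ℂ)] (P.eval (MvPolynomial.C b)) =
        (P.map (MvPolynomial.eval ![(n : ℂ), (m : ℂ)])).eval b := fun P => by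
    have h := Polynomial.eval₂_at_apply (p := P) (MvPolynomial.eval ![(n : ℂ), (m : ℂ)])
      (MvPolynomial.C b)
    rw [MvPolynomial.eval_C] at h
    rw [Polynomial.eval_map, h]
  have hne : evenDet N (wave p q c r n m) ≠ 0 := by
    rw [fCas_eq_evenDet Ap Am hp hq hc hr] at hf
    exact right_ne_zero_of_mul hf
  refine ⟨right_ne_zero_of_mul (hfY ▸ hne), ?_⟩
  rw [S_eq_sval hp hq hc ha hb hr hf, sval, hfY]
  split_ifs
  · rw [(hasDerivAt_thetaDet_of_poly _ hΘ hb).deriv]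
    refine Eq.trans ?_ (mul_div_mul_left _ _ hμ)
    congr 1
    simp only [map_neg, map_mul, map_add, MvPolynomial.eval_C, hev, Polynomial.derivative_map,
      Polynomial.derivative_C_mul, Polynomial.eval_mul, Polynomial.eval_C]
    ring
  · rw [thetaDet, hΘ]
    refine Eq.trans ?_ (mul_div_mul_left _ _ hμ)
    congr 1
    simp only [map_neg, map_mul, map_sub, MvPolynomial.eval_C, hev, Polynomial.eval_mul,
      Polynomial.eval_C]
    ring

theorem edgeRelation_left (hp : p ≠ 0) (hq : q ≠ 0) (hc : c ≠ 0) (hr : AnalyticAt ℂ r c)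
    {n m : ℤ} (hf : fCas Ap Am p q c r n m ≠ 0) (hf' : fCas Ap Am p q c r (n + 1) m ≠ 0) :
    EdgeRelation p (fun x y => S Ap Am p q c r x y n m)
      (fun x y => S Ap Am p q c r x y (n + 1) m) (fun x => vval N (wave p q c r n m) x)
      fun x => vval N (wave p q c r (n + 1) m) x := by
  intro x y hx hy
  simp only [S_eq_sval hp hq hc hx hy hr hf, S_eq_sval hp hq hc hx hy hr hf']
  rw [fCas_eq_evenDet Ap Am hp hq hc hr] at hf hf'
  have hf := right_ne_zero_of_mul hf
  have hf' := right_ne_zero_of_mul hf'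
  rw [wave_succ_left hp] at hf' ⊢
  exact edgeRelation_sval p hf hf' x y hx hy

theorem edgeRelation_right (hp : p ≠ 0) (hq : q ≠ 0) (hc : c ≠ 0) (hr : AnalyticAt ℂ r c)
    {n m : ℤ} (hf : fCas Ap Am p q c r n m ≠ 0) (hf' : fCas Ap Am p q c r n (m + 1) ≠ 0) :
    EdgeRelation q (fun x y => S Ap Am p q c r x y n m)
      (fun x y => S Ap Am p q c r x y n (m + 1)) (fun x => vval N (wave p q c r n m) x)
      fun x => vval N (wave p q c r n (m + 1)) x := by
  intro x y hx hy
  simp only [S_eq_sval hp hq hc hx hy hr hf, S_eq_sval hp hq hc hx hy hr hf']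
  rw [fCas_eq_evenDet Ap Am hp hq hc hr] at hf hf'
  have hf := right_ne_zero_of_mul hf
  have hf' := right_ne_zero_of_mul hf'
  rw [wave_succ_right hq] at hf' ⊢
  exact edgeRelation_sval q hf hf' x y hx hy

theorem symmetricOn_S (hp : p ≠ 0) (hq : q ≠ 0) (hc : c ≠ 0) (hr : AnalyticAt ℂ r c)
    {n m : ℤ} (hf : fCas Ap Am p q c r n m ≠ 0) :
    SymmetricOn fun x y => S Ap Am p q c r x y n m := by
  intro x y hx hy
  simp only [S_eq_sval hp hq hc hx hy hr hf, S_eq_sval hp hq hc hy hx hr hf]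
  exact symmetricOn_sval N _ x y hx hy

end Main
end LatticeQ3

theorem theorem1 (N : ℕ) (p P q Q a b c δ A B C D : ℂ)
    (hp : p ≠ 0) (hq : q ≠ 0) (ha : a ≠ 0) (hb : b ≠ 0) (hc : c ≠ 0)
    (hP : P ^ 2 = (p ^ 2 - a ^ 2) * (p ^ 2 - b ^ 2))
    (hQ : Q ^ 2 = (q ^ 2 - a ^ 2) * (q ^ 2 - b ^ 2))
    (hP0 : P ≠ 0) (hQ0 : Q ≠ 0)
    (r : ℂ → ℂ) (hr : LatticeQ3.IsSqrtBranch r c)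
    (Ap Am : Matrix (Fin N) (Fin N) ℂ)
    (hAp : LatticeQ3.IsLowerToeplitz Ap) (hAp0 : Ap.det ≠ 0)
    (hAm : LatticeQ3.IsLowerToeplitz Am) (hAm0 : Am.det ≠ 0)
    (hABCD : A * D * (a + b) ^ 2 - B * C * (a - b) ^ 2 = -(δ ^ 2 / (16 * a * b))) :
    (∀ a₁ b₁ : ℂ, (a₁ = a ∨ a₁ = -a) → (b₁ = b ∨ b₁ = -b) →
      LatticeQ3.IsRationalWhere (LatticeQ3.fCas Ap Am p q c r)
          (LatticeQ3.S Ap Am p q c r a₁ b₁) ∧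
        ∀ n m : ℤ, LatticeQ3.NonvanishingOnSquare (LatticeQ3.fCas Ap Am p q c r) n m →
          LatticeQ3.NQC p q a₁ b₁ (LatticeQ3.S Ap Am p q c r a₁ b₁) n m) ∧
      ∀ n m : ℤ, LatticeQ3.NonvanishingOnSquare (LatticeQ3.fCas Ap Am p q c r) n m →
        LatticeQ3.Q3 p P q Q δ
          (LatticeQ3.uSol p P q Q a b A B C D (LatticeQ3.S Ap Am p q c r)) n m := by
  open LatticeQ3 in
  have hr' := hr.1
  refine ⟨fun a₁ b₁ ha₁ hb₁ => ?_, fun n m ⟨f, f₁, f₂, f₁₂⟩ => ?_⟩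
  · have ha₁' : a₁ ≠ 0 := by rcases ha₁ with rfl | rfl <;> simpa
    have hb₁' : b₁ ≠ 0 := by rcases hb₁ with rfl | rfl <;> simpa
    refine ⟨isRationalWhere_S hp hq hc ha₁' hb₁' hr', fun n m ⟨f, f₁, f₂, f₁₂⟩ => ?_⟩
    exact nqc_of_edgeRelation (V := fun x n m => vval N (wave p q c r n m) x) ha₁' hb₁'
      (symmetricOn_S hp hq hc hr' f₁) (symmetricOn_S hp hq hc hr' f₂)
      (symmetricOn_S hp hq hc hr' f₁₂) (edgeRelation_left hp hq hc hr' f f₁)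
      (edgeRelation_right hp hq hc hr' f f₂) (edgeRelation_right hp hq hc hr' f₁ f₁₂)
      (edgeRelation_left hp hq hc hr' f₂ f₁₂)
  · exact q3_of_edgeRelation (V := fun x n m => vval N (wave p q c r n m) x) ha hb hP hQ hP0 hQ0
      hABCD (symmetricOn_S hp hq hc hr' f) (symmetricOn_S hp hq hc hr' f₁)
      (symmetricOn_S hp hq hc hr' f₂) (symmetricOn_S hp hq hc hr' f₁₂)
      (edgeRelation_left hp hq hc hr' f f₁) (edgeRelation_right hp hq hc hr' f f₂)
      (edgeRelation_right hp hq hc hr' f₁ f₁₂) (edgeRelation_left hp hq hc hr' f₂ f₁₂)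

end
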